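/- **Definitions.** For a graph $F$ and $h\colon V(F)\to\mathbb Z_{\ge 0}$, the *blow-up* $F(h)$ arises from $F$ by replacing each vertex $z$ by an independent set of size $h(z)$ (possibly empty) and each edge by a complete bipartite graph; for constant $h=p$ write $F(p)$. For $i\ge 2$ let $\Gamma_i$ be the Andrásfai graph on $\{v_0,\dots,v_{3i-2}\}$ with $v_jv_\ell$ an edge iff $i\le|j-\ell|\le 2i-1$. The Vega graph $\Upsilon_i=\Upsilon_i^{00}$ is obtained from $\Gamma_i$ by adding an edge $xy$ and an induced $6$-cycle $avcubw$, joining $x$ to $a,b,c$ and $y$ to $u,v,w$, and joining $a,u$ to $v_0,\dots,v_{i-1}$; $b,v$ to $v_i,\dots,v_{2i-1}$; and $c,w$ to $v_{2i},\dots,v_{3i-2}$. For $\mu,\nu\in\{0,1\}$, the Vega graph $\Upsilon_i^{\mu\nu}$ is obtained from $\Upsilon_i$ by deleting $y$ if $\mu=1$ and deleting $v_{2i-1}$ if $\nu=1$. Define $\omega_{00}\colon V(\Upsilon_i)\to\mathbb Z$ to be $1$ on $x,y,v_0,v_{2i-1}$; $3i-2$ on $a,b,u,v$; $3i-3$ on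 $c,w$; and $3$ on all other $v_j$. Let $f$ be $1$ on $u,v,w,y$, $-1$ on $x$, and $0$ elsewhere; let $g$ be $1$ on $b,v,v_{i-1},v_{2i-1}$, $-1$ on $v_0$, and $0$ elsewhere. Put $\omega_{\mu\nu}=\omega_{00}-\mu f-\nu g$ (which is positive on $V(\Upsilon_i^{\mu\nu})$) and $G_i^{\mu\nu}=\Upsilon_i^{\mu\nu}(\omega_{\mu\nu})$. Further let $$g_k(n,s)=\tfrac12k(k-1)n^2-k(3k-4)ns+\tfrac12(3k-4)(3k-1)s^2,\qquad \lambda=(3k-1)s-kn.$$ For $k\ge 10$ and $n\ge s\ge 1$ let $\mathscr H^n_k(s)$ be the family consisting exactly of the following graphs, where $i\ge2$ and $\mu,\nu\in\{0,1\}$: (a) if $s=\frac{kn}{3k-1}$, the graphs $G_i^{\mu\nu}(3s-n)$ with $k=9i-(6+\mu+\nu)$; (b) if $\frac{kn}{3k-1}<s\le\frac{(k-1)n}{3k-4}$, the graphs $\Upsilon_i^{0\nu}\bigl((3s-n)\omega_{0\nu}-\lambda f\bigr)$ with $k=9i-(6+\nu)$; (c) if $\frac{kn}{3k-1}<s\le\frac{(k-1)n}{3k-4}$,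 the graphs $\Upsilon_i^{\mu0}\bigl((3s-n)\omega_{\mu0}-\lambda g\bigr)$ with $k=9i-(6+\mu)$. **Lemma.** Let $i\ge 2$, $\mu,\nu\in\{0,1\}$, $n\ge s\ge 1$, and $k=9i-(6+\mu+\nu)$. Let $H$ be an $n$-vertex blow-up of $\Upsilon_i^{\mu\nu}$ with independence number $\alpha(H)\le s$ and with $e(H)=g_k(n,s)$ edges. Then $H$ is isomorphic to a graph in $\mathscr H^n_k(s)$. More precisely, $H\cong\Upsilon_i^{\mu\nu}(h)$ for some $h$ such that either $s=\frac{kn}{3k-1}$ and $h=(3s-n)\omega_{\mu\nu}$; or $\frac{kn}{3k-1}<s\le\frac{(k-1)n}{3k-4}$ and at least one of the following holds: $\mu=0$ and $h=(3s-n)\omega_{\mu\nu}-\lambda f$, or $\nu=0$ and $h=(3s-n)\omega_{\mu\nu}-\lambda g$. -/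

import Mathlib

namespace VegaExtremal

/-- The blow-up `F(h)`: every vertex `z` of `F` is replaced by an independent set of size `h z`,
and every edge of `F` by a complete bipartite graph. Empty vertex classes are allowed. -/
def blowUp {α : Type} (F : SimpleGraph α) (h : α → ℕ) : SimpleGraph (Σ z : α, Fin (h z)) :=
  F.comap Sigma.fst

/-- `H` is (up to isomorphism) a blow-up of `F`. -/
def IsBlowUp {α : Type} {V : Type*} (H : SimpleGraph V) (F : SimpleGraph α) : Prop :=
  ∃ h : α → ℕ, Nonempty (H ≃g blowUp F h)

/-- The Andrásfai graph `Γ_k` on `v_0, …, v_{3k-2}`. -/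
def andrasfai (k : ℕ) : SimpleGraph (Fin (3 * k - 1)) where
  Adj p q := k ≤ ((p : ℤ) - (q : ℤ)).natAbs ∧ ((p : ℤ) - (q : ℤ)).natAbs ≤ 2 * k - 1
  symm := ⟨fun p q h => by omega⟩
  loopless := ⟨fun p h => by have := p.isLt; omega⟩

/-- The `3i + 7` vertices of the Vega graph `Υ_i`; `inner j` is the vertex `v_j` of `Γ_i`. -/
inductive VegaVertex (i : ℕ) : Type
  | x | y | a | b | c | u | v | w
  | inner (j : Fin (3 * i - 1))
  deriving DecidableEq, Fintype

/-- The edges of `Υ_i`, each listed in at least one orientation. -/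
def vegaRel (i : ℕ) : VegaVertex i → VegaVertex i → Prop
  -- the Andrásfai graph in the middle
  | .inner p, .inner q => (andrasfai i).Adj p q
  -- the edge `xy`
  | .x, .y => True
  -- the 6-cycle `avcubw`
  | .a, .v => True
  | .v, .c => True
  | .c, .u => True
  | .u, .b => True
  | .b, .w => True
  | .w, .a => True
  -- `x` is joined to `a, b, c`, and `y` to `u, v, w`
  | .x, .a => True
  | .x, .b => True
  | .x, .c => True
  | .y, .u => True
  | .y, .v => True
  | .y, .w => True
  -- the edges between the 6-cycle and the Andrásfai graph
  | .a, .inner j => (j : ℕ) ≤ i - 1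
  | .u, .inner j => (j : ℕ) ≤ i - 1
  | .b, .inner j => i ≤ (j : ℕ) ∧ (j : ℕ) ≤ 2 * i - 1
  | .v, .inner j => i ≤ (j : ℕ) ∧ (j : ℕ) ≤ 2 * i - 1
  | .c, .inner j => 2 * i ≤ (j : ℕ)
  | .w, .inner j => 2 * i ≤ (j : ℕ)
  | _, _ => False

/-- The Vega graph `Υ_i = Υ_i^{00}` (for `i ≥ 2`). -/
def vega (i : ℕ) : SimpleGraph (VegaVertex i) :=
  SimpleGraph.fromRel (vegaRel i)

/-- The vertex set of `Υ_i^{μν}`: the vertex `y` is deleted if `μ = 1`, and the vertex `v_{2i-1}`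
is deleted if `ν = 1`. -/
def vegaVerts (i : ℕ) (μ ν : Fin 2) : Set (VegaVertex i) :=
  {z | ¬ (μ = 1 ∧ z = .y) ∧ ¬ (ν = 1 ∧ ∃ j, z = .inner j ∧ (j : ℕ) = 2 * i - 1)}

/-- The Vega graph `Υ_i^{μν}`. -/
def vegaDel (i : ℕ) (μ ν : Fin 2) : SimpleGraph (vegaVerts i μ ν) :=
  (vega i).induce (vegaVerts i μ ν)

/-- The weight function `ω_{00}`. -/
def omegaZero (i : ℕ) : VegaVertex i → ℤ
  | .x | .y => 1
  | .a | .b | .u | .v => 3 * i - 2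
  | .c | .w => 3 * i - 3
  | .inner j => if (j : ℕ) = 0 ∨ (j : ℕ) = 2 * i - 1 then 1 else 3

/-- The function `f`. -/
def f (i : ℕ) : VegaVertex i → ℤ
  | .u | .v | .w | .y => 1
  | .x => -1
  | _ => 0

/-- The function `g`. -/
def g (i : ℕ) : VegaVertex i → ℤ
  | .b | .v => 1
  | .inner j =>
      if (j : ℕ) = 0 then -1
      else if (j : ℕ) = i - 1 ∨ (j : ℕ) = 2 * i - 1 then 1
      else 0
  | _ => 0

/-- The weight function `ω_{μν} = ω_{00} - μ f - ν g`. -/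
def omega (i : ℕ) (μ ν : Fin 2) (z : VegaVertex i) : ℤ :=
  omegaZero i z - ((μ : ℕ) : ℤ) * f i z - ((ν : ℕ) : ℤ) * g i z

/-- The graph `G_i^{μν} = Υ_i^{μν}(ω_{μν})`; for `i ≥ 2` the weight `ω_{μν}` is positive on the
vertices of `Υ_i^{μν}`. -/
def vegaRegular (i : ℕ) (μ ν : Fin 2) :
    SimpleGraph (Σ z : vegaVerts i μ ν, Fin (omega i μ ν z).toNat) :=
  blowUp (vegaDel i μ ν) fun z => (omega i μ ν z).toNat

/-- The quadratic function `g_k(n, s)`. -/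
def edgeBound (k n s : ℕ) : ℚ :=
  (k : ℚ) * (k - 1) * n ^ 2 / 2 - k * (3 * k - 4) * n * s + (3 * k - 4) * (3 * k - 1) * s ^ 2 / 2

/-- The number `λ = (3k-1)s - kn`. -/
def lam (k n s : ℕ) : ℤ := (3 * (k : ℤ) - 1) * s - k * n

/-- The family `ℋ^n_k(s)`, the smallest collection of graphs with the three closure properties.
In the first constructor `n ≤ 3s`, so that the natural subtraction `3s - n` is the true one. -/
inductive ExtremalFamily (n k s : ℕ) : (W : Type) → SimpleGraph W → Prop
  | balanced (i : ℕ) (μ ν : Fin 2) (hi : 2 ≤ i) (hk : k = 9 * i - (6 + (μ : ℕ) + (ν : ℕ)))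
      (hs : (s : ℚ) = k * n / (3 * k - 1)) :
      ExtremalFamily n k s _ (blowUp (vegaRegular i μ ν) fun _ => 3 * s - n)
  | alongF (i : ℕ) (ν : Fin 2) (hi : 2 ≤ i) (hk : k = 9 * i - (6 + (ν : ℕ)))
      (hs : (k : ℚ) * n / (3 * k - 1) < s) (hs' : (s : ℚ) ≤ (k - 1) * n / (3 * k - 4))
      (h : vegaVerts i 0 ν → ℕ)
      (hh : ∀ z, (h z : ℤ) = (3 * (s : ℤ) - n) * omega i 0 ν z - lam k n s * f i z) :
      ExtremalFamily n k s _ (blowUp (vegaDel i 0 ν) h)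
  | alongG (i : ℕ) (μ : Fin 2) (hi : 2 ≤ i) (hk : k = 9 * i - (6 + (μ : ℕ)))
      (hs : (k : ℚ) * n / (3 * k - 1) < s) (hs' : (s : ℚ) ≤ (k - 1) * n / (3 * k - 4))
      (h : vegaVerts i μ 0 → ℕ)
      (hh : ∀ z, (h z : ℤ) = (3 * (s : ℤ) - n) * omega i μ 0 z - lam k n s * g i z) :
      ExtremalFamily n k s _ (blowUp (vegaDel i μ 0) h)

end VegaExtremal

/-! The proof is linear algebra over the adjacency matrix `A` of `Υ_i`. Let `h` be the class sizes,
`n` their sum, `K = 9i - 6`, and `d = s - A h` the defect. As `Υ_i` is triangle-free, neighbourhoods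
are independent, so `α(H) ≤ s` gives `d ≥ 0`.

The weight `ω₀₀` satisfies `A ω₀₀ = K 𝟙` and has total `3K - 1`, and an explicit symmetric matrix
`C` satisfies `A C = I + 𝟙 ω₀₀ᵀ` (`nbrSum_vegaInv`). Hence `h = (3s - n) ω₀₀ - C d`. If `y` or
`v_{2i-1}` is deleted, then `h` vanishes there. Since the rows of `C` at these vertices are `f` and
`g`, this fixes `f·d` or `g·d` as `3s - n`, so the same formula holds with `ω_{μν}` and `C_{μν}`,
and `ω_{μν}·d = λ`.

Counting edges gives `h·d = ns - 2e(H)`, which equals `λ(3s - n - λ)` when `e(H) = g_k(n,s)`.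
Substituting the formula for `h` yields `dᵀ C_{μν} d = (ω_{μν}·d)²`. Entrywise `C_{μν} ≤ ω_{μν}
ω_{μν}ᵀ`, strictly except at diagonal entries of light vertices (`vegaInvDel_lt`). So on the
remaining vertices `d` is zero or lives on one light vertex `z`, where it equals `λ`; then `h = (3s
- n) ω_{μν} - λ C_z`. Two automorphisms of `Υ_i` reduce `z` to `y` or `v_{2i-1}`, that is, `C_z` to
`f` or `g`. -/

namespace VegaExtremal

open Finset

/-! ### Neighbourhood sums in `Υ_i` -/

open scoped Classical in
/-- The sum of `F` over the neighbours of `z` in `Υ_i`. -/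
noncomputable def nbrSum (i : ℕ) (F : VegaVertex i → ℤ) (z : VegaVertex i) : ℤ :=
  ∑ z', if (vega i).Adj z z' then F z' else 0

theorem sum_vegaVertex {M : Type*} [AddCommMonoid M] {i : ℕ} (F : VegaVertex i → M) :
    ∑ z, F z = F .x + F .y + F .a + F .b + F .c + F .u + F .v + F .w + ∑ j, F (.inner j) := by
  have h : (univ : Finset (VegaVertex i)) =
      {.x, .y, .a, .b, .c, .u, .v, .w} ∪ univ.image .inner := by
    ext z; cases z <;> simp
  rw [h, sum_union, sum_image (by intro p _ q _ h; simpa using h)]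
  · congr 1
    simp [add_assoc]
  · rw [disjoint_left]; intro z hz; fin_cases hz <;> simp

theorem vega_adj {i : ℕ} (z z' : VegaVertex i) :
    (vega i).Adj z z' ↔ z ≠ z' ∧ (vegaRel i z z' ∨ vegaRel i z' z) := by
  simp [vega]

theorem vega_adj_inner {i : ℕ} (p q : Fin (3 * i - 1)) :
    (vega i).Adj (.inner p) (.inner q) ↔
      i ≤ ((p : ℤ) - (q : ℤ)).natAbs ∧ ((p : ℤ) - (q : ℤ)).natAbs ≤ 2 * i - 1 := by
  change _ ↔ (andrasfai i).Adj p q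
  simp only [vega_adj, vegaRel, (andrasfai i).adj_comm q p, or_self, ne_eq,
    VegaVertex.inner.injEq, and_iff_right_iff_imp]
  exact fun h => h.ne

section nbrSum
variable {i : ℕ} (F : VegaVertex i → ℤ)

theorem nbrSum_x : nbrSum i F .x = F .y + F .a + F .b + F .c := by
  simp [nbrSum, sum_vegaVertex, vega_adj, vegaRel]

theorem nbrSum_y : nbrSum i F .y = F .x + F .u + F .v + F .w := by
  simp [nbrSum, sum_vegaVertex, vega_adj, vegaRel]

theorem nbrSum_a : nbrSum i F .a = F .x + F .v + F .w +
    ∑ j : Fin (3 * i - 1), if (j : ℕ) ≤ i - 1 then F (.inner j) else 0 := by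
  simp [nbrSum, sum_vegaVertex, vega_adj, vegaRel]

theorem nbrSum_u : nbrSum i F .u = F .y + F .b + F .c +
    ∑ j : Fin (3 * i - 1), if (j : ℕ) ≤ i - 1 then F (.inner j) else 0 := by
  simp [nbrSum, sum_vegaVertex, vega_adj, vegaRel]

theorem nbrSum_b : nbrSum i F .b = F .x + F .u + F .w +
    ∑ j : Fin (3 * i - 1), if i ≤ (j : ℕ) ∧ (j : ℕ) ≤ 2 * i - 1 then F (.inner j) else 0 := by
  simp [nbrSum, sum_vegaVertex, vega_adj, vegaRel]

theorem nbrSum_v : nbrSum i F .v = F .y + F .a + F .c +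
    ∑ j : Fin (3 * i - 1), if i ≤ (j : ℕ) ∧ (j : ℕ) ≤ 2 * i - 1 then F (.inner j) else 0 := by
  simp [nbrSum, sum_vegaVertex, vega_adj, vegaRel]

theorem nbrSum_c : nbrSum i F .c = F .x + F .u + F .v +
    ∑ j : Fin (3 * i - 1), if 2 * i ≤ (j : ℕ) then F (.inner j) else 0 := by
  simp [nbrSum, sum_vegaVertex, vega_adj, vegaRel]

theorem nbrSum_w : nbrSum i F .w = F .y + F .a + F .b +
    ∑ j : Fin (3 * i - 1), if 2 * i ≤ (j : ℕ) then F (.inner j) else 0 := by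
  simp [nbrSum, sum_vegaVertex, vega_adj, vegaRel]

theorem nbrSum_inner (l : Fin (3 * i - 1)) : nbrSum i F (.inner l) =
    (if (l : ℕ) ≤ i - 1 then F .a + F .u else if (l : ℕ) ≤ 2 * i - 1 then F .b + F .v
      else F .c + F .w) +
    ∑ j : Fin (3 * i - 1), if i ≤ ((l : ℤ) - (j : ℤ)).natAbs ∧
      ((l : ℤ) - (j : ℤ)).natAbs ≤ 2 * i - 1 then F (.inner j) else 0 := by
  simp only [nbrSum, sum_vegaVertex, vega_adj_inner]
  congr 1
  have := l.isLt
  simp only [vega_adj, vegaRel, or_false, false_or, ne_eq, reduceCtorEq, not_false_eq_true,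
    true_and, and_false, if_false, zero_add]
  split_ifs <;> omega

end nbrSum

/-- Symmetry of the adjacency matrix; every later identity arises by moving `A` from one factor to
the other. -/
theorem sum_mul_nbrSum_comm {i : ℕ} (F G : VegaVertex i → ℤ) :
    ∑ z, F z * nbrSum i G z = ∑ z, G z * nbrSum i F z := by
  simp only [nbrSum, mul_sum]
  rw [sum_comm]
  refine sum_congr rfl fun z _ => sum_congr rfl fun z' _ => ?_
  rw [(vega i).adj_comm]
  split_ifs <;> ring

/-! ### The matrix `C` and counts of neighbours in `Γ_i` -/

/-- The symmetric integer matrix `C` with `A C = I + 𝟙 ω₀₀ᵀ`, where `A` is the adjacency matrix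
of `Υ_i`. -/
def vegaInv (i : ℕ) : VegaVertex i → VegaVertex i → ℤ
  | .x, .x | .y, .y => 1
  | .x, .y | .y, .x => -1
  | .x, .a | .x, .b | .x, .c | .a, .x | .b, .x | .c, .x => 1
  | .y, .u | .y, .v | .y, .w | .u, .y | .v, .y | .w, .y => 1
  | .x, _ | _, .x | .y, _ | _, .y => 0
  | .inner j, .inner l =>
      if j = l then 1
      else if ((j : ℕ) = 0 ∧ (l : ℕ) = 2 * i - 1) ∨ ((l : ℕ) = 0 ∧ (j : ℕ) = 2 * i - 1) then -1
      else if ((j : ℤ) - (l : ℤ)).natAbs = i ∨ ((j : ℤ) - (l : ℤ)).natAbs = 2 * i - 1 then 1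
      else 0
  | .inner j, .a | .inner j, .u | .a, .inner j | .u, .inner j =>
      if (j : ℕ) = 2 * i - 1 then 0 else 1
  | .inner j, .b | .inner j, .v | .b, .inner j | .v, .inner j => if (j : ℕ) = 0 then 0 else 1
  | .inner j, .c | .inner j, .w | .c, .inner j | .w, .inner j =>
      if (j : ℕ) = 0 ∨ (j : ℕ) = 2 * i - 1 then 0 else 1
  | .a, .a | .b, .b | .u, .u | .v, .v => i
  | .c, .w | .w, .c => i - 2
  | _, _ => i - 1

theorem vegaInv_comm {i : ℕ} (z z' : VegaVertex i) : vegaInv i z z' = vegaInv i z' z := by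
  cases z <;> cases z' <;> first | rfl | (simp only [vegaInv]; split_ifs <;> first | rfl | omega)

section innerSums
variable {m : ℕ} (P : Fin m → Prop) [DecidablePred P]

theorem sum_ite_affine (F : Fin m → ℤ) (c α β : ℤ) (p q : Fin m)
    (hF : ∀ j, F j = c - α * (if j = p then 1 else 0) - β * (if j = q then 1 else 0)) :
    (∑ j, if P j then F j else 0) = c * (∑ j, if P j then 1 else 0) -
      α * (if P p then 1 else 0) - β * (if P q then 1 else 0) := by
  have h : ∀ j, (if P j then F j else 0) = c * (if P j then 1 else 0)
      - α * (if j = p then (if P j then 1 else 0) else 0)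
      - β * (if j = q then (if P j then 1 else 0) else 0) := by
    intro j; rw [hF]; split_ifs <;> ring
  simp only [h, sum_sub_distrib, ← mul_sum, sum_ite_eq', mem_univ, if_true]

theorem sum_ite_deltas (F : Fin m → ℤ) (β γ : ℤ) (p q r : Fin m)
    (hF : ∀ j, F j = (if j = p then 1 else 0) + β * (if j = q then 1 else 0)
      + γ * (if j = r then 1 else 0)) :
    (∑ j, if P j then F j else 0) = (if P p then 1 else 0) +
      β * (if P q then 1 else 0) + γ * (if P r then 1 else 0) := by
  have h : ∀ j, (if P j then F j else 0) = (if j = p then (if P j then 1 else 0) else 0)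
      + β * (if j = q then (if P j then 1 else 0) else 0)
      + γ * (if j = r then (if P j then 1 else 0) else 0) := by
    intro j; rw [hF]; split_ifs <;> ring
  simp only [h, sum_add_distrib, ← mul_sum, sum_ite_eq', mem_univ, if_true]

end innerSums

section counts
variable {i : ℕ}

theorem count_fin_eq {m : ℕ} (P : ℕ → Prop) [DecidablePred P] (S : Finset ℕ)
    (hS : ∀ j, j ∈ S ↔ j < m ∧ P j) :
    (∑ j : Fin m, if P j then (1 : ℤ) else 0) = #S := by
  rw [Fin.sum_univ_eq_sum_range (fun j => if P j then (1 : ℤ) else 0), sum_boole]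
  congr 2
  ext j; simp [hS]

theorem count_low (hi : 2 ≤ i) :
    (∑ j : Fin (3 * i - 1), if (j : ℕ) ≤ i - 1 then (1 : ℤ) else 0) = i := by
  rw [count_fin_eq (fun j => j ≤ i - 1) (Finset.Ico 0 i) (by intro j; rw [mem_Ico]; omega)]
  simp

theorem count_mid (hi : 2 ≤ i) :
    (∑ j : Fin (3 * i - 1), if i ≤ (j : ℕ) ∧ (j : ℕ) ≤ 2 * i - 1 then (1 : ℤ) else 0) = i := by
  rw [count_fin_eq (fun j => i ≤ j ∧ j ≤ 2 * i - 1) (Finset.Ico i (2 * i))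
    (by intro j; rw [mem_Ico]; omega), Nat.card_Ico]
  omega

theorem count_high (hi : 2 ≤ i) :
    (∑ j : Fin (3 * i - 1), if 2 * i ≤ (j : ℕ) then (1 : ℤ) else 0) = i - 1 := by
  rw [count_fin_eq (fun j => 2 * i ≤ j) (Finset.Ico (2 * i) (3 * i - 1))
    (by intro j; rw [mem_Ico]; omega), Nat.card_Ico]
  omega

theorem count_andrasfai (hi : 2 ≤ i) (l : Fin (3 * i - 1)) :
    (∑ j : Fin (3 * i - 1), if i ≤ ((l : ℤ) - (j : ℤ)).natAbs ∧
      ((l : ℤ) - (j : ℤ)).natAbs ≤ 2 * i - 1 then (1 : ℤ) else 0) = i := by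
  obtain ⟨l, hl⟩ := l
  simp only
  rw [count_fin_eq (fun j => i ≤ ((l : ℤ) - (j : ℤ)).natAbs ∧
      ((l : ℤ) - (j : ℤ)).natAbs ≤ 2 * i - 1)
      -- The neighbours below and above `l`; truncated subtraction and the `min` cut both intervals
      -- to the index range.
      (Finset.Ico (l + 1 - 2 * i) (l + 1 - i) ∪ Finset.Ico (l + i) (min (l + 2 * i) (3 * i - 1)))
      (by intro j; rw [mem_union, mem_Ico, mem_Ico]; omega), card_union_of_disjoint, Nat.card_Ico,
      Nat.card_Ico]
  · omega
  · rw [disjoint_left]; intro j; rw [mem_Ico, mem_Ico]; omega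

end counts

/-! ### The identities `A ω₀₀ = (9i - 6) 𝟙` and `A C = I + 𝟙 ω₀₀ᵀ` -/

section identities
variable {i : ℕ}

/-- A function on `Υ_i` whose restriction to `Γ_i` is constant up to corrections at
`v_0` and `v_{2i-1}`. -/
theorem nbrSum_of_affine (hi : 2 ≤ i) (F : VegaVertex i → ℤ) (c α β : ℤ)
    (hF : ∀ j, F (.inner j) = c - α * (if (j : ℕ) = 0 then 1 else 0)
      - β * (if (j : ℕ) = 2 * i - 1 then 1 else 0)) (z : VegaVertex i) :
    nbrSum i F z = match z with
      | .x => F .y + F .a + F .b + F .c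
      | .y => F .x + F .u + F .v + F .w
      | .a => F .x + F .v + F .w + (c * i - α)
      | .u => F .y + F .b + F .c + (c * i - α)
      | .b => F .x + F .u + F .w + (c * i - β)
      | .v => F .y + F .a + F .c + (c * i - β)
      | .c => F .x + F .u + F .v + c * (i - 1)
      | .w => F .y + F .a + F .b + c * (i - 1)
      | .inner l => (if (l : ℕ) ≤ i - 1 then F .a + F .u - β
          else if (l : ℕ) ≤ 2 * i - 1 then F .b + F .v - α else F .c + F .w) + c * i := by
  have hF' : ∀ j, F (.inner j) = c - α * (if j = ⟨0, by omega⟩ then 1 else 0)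
      - β * (if j = ⟨2 * i - 1, by omega⟩ then 1 else 0) := by
    intro j; rw [hF]; simp only [Fin.ext_iff]
  cases z with
  | x => exact nbrSum_x F
  | y => exact nbrSum_y F
  | a | u =>
    simp only [nbrSum_a, nbrSum_u]
    rw [sum_ite_affine _ _ c α β _ _ hF', count_low hi, if_pos (by simp only; omega),
      if_neg (by simp only; omega)]
    ring
  | b | v =>
    simp only [nbrSum_b, nbrSum_v]
    rw [sum_ite_affine _ _ c α β _ _ hF', count_mid hi, if_neg (by simp only; omega),
      if_pos (by simp only; omega)]
    ring
  | c | w =>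
    simp only [nbrSum_c, nbrSum_w]
    rw [sum_ite_affine _ _ c α β _ _ hF', count_high hi, if_neg (by simp only; omega),
      if_neg (by simp only; omega)]
    ring
  | inner l =>
    have hl := l.isLt
    simp only [nbrSum_inner]
    rw [sum_ite_affine _ _ c α β _ _ hF', count_andrasfai hi]
    simp only
    split_ifs <;> omega

theorem nbrSum_omegaZero (hi : 2 ≤ i) (z : VegaVertex i) :
    nbrSum i (omegaZero i) z = 9 * i - 6 := by
  rw [nbrSum_of_affine hi _ 3 2 2 (by intro j; simp only [omegaZero]; split_ifs <;> omega)]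
  cases z <;> simp only [omegaZero] <;> (try split_ifs) <;> ring

/-- The indices `j + i` and `j - i` modulo `3i - 1`: together with `j`, these support the row of `C`
at `v_j` within `Γ_i`. -/
theorem exists_shift (hi : 2 ≤ i) (j : Fin (3 * i - 1)) : ∃ p q : Fin (3 * i - 1),
    ((p : ℕ) = j + i ∨ (p : ℕ) + (3 * i - 1) = j + i) ∧
    ((q : ℕ) + i = j ∨ (q : ℕ) + i = j + (3 * i - 1)) := by
  have hj := j.isLt
  refine ⟨⟨if (j : ℕ) + i < 3 * i - 1 then j + i else j + i - (3 * i - 1), by split_ifs <;> omega⟩,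
    ⟨if i ≤ (j : ℕ) then j - i else j + (3 * i - 1) - i, by split_ifs <;> omega⟩, ?_, ?_⟩
  · simp only; split_ifs <;> omega
  · simp only; split_ifs <;> omega

theorem vegaInv_inner_inner (hi : 2 ≤ i) (j p q : Fin (3 * i - 1))
    (hp : (p : ℕ) = j + i ∨ (p : ℕ) + (3 * i - 1) = j + i)
    (hq : (q : ℕ) + i = j ∨ (q : ℕ) + i = j + (3 * i - 1)) (l : Fin (3 * i - 1)) :
    vegaInv i (.inner j) (.inner l) = (if l = j then 1 else 0) +
      (if (j : ℕ) = 2 * i - 1 then -1 else 1) * (if l = p then 1 else 0) +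
      (if (j : ℕ) = 0 then -1 else 1) * (if l = q then 1 else 0) := by
  have := j.isLt
  have := l.isLt
  simp only [vegaInv, Fin.ext_iff]
  split_ifs <;> omega

/-- The adjacency matrix of `Γ_i`. -/
def andrasfaiAdj (i l j : ℕ) : ℤ :=
  if i ≤ ((l : ℤ) - (j : ℤ)).natAbs ∧ ((l : ℤ) - (j : ℤ)).natAbs ≤ 2 * i - 1 then 1 else 0

theorem andrasfaiAdj_zero (l : ℕ) :
    andrasfaiAdj i l 0 = if i ≤ l ∧ l ≤ 2 * i - 1 then 1 else 0 :=
  if_congr (by omega) rfl rfl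

theorem andrasfaiAdj_mid (hi : 2 ≤ i) {l : ℕ} (hl : l < 3 * i - 1) :
    andrasfaiAdj i l (2 * i - 1) = if l ≤ i - 1 then 1 else 0 :=
  if_congr (by omega) rfl rfl

/-- Modulo `3i - 1`, the neighbourhoods of `v_j`, `v_{j+i}`, `v_{j-i}` are three arcs of length `i`
that cover the cycle once, except that `v_j` is covered twice. -/
theorem andrasfaiAdj_triple (hi : 2 ≤ i) {l j p q : ℕ} (hj : j < 3 * i - 1) (hl : l < 3 * i - 1)
    (hpi : p < 3 * i - 1) (hqi : q < 3 * i - 1)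
    (hp : p = j + i ∨ p + (3 * i - 1) = j + i) (hq : q + i = j ∨ q + i = j + (3 * i - 1)) :
    andrasfaiAdj i l j + andrasfaiAdj i l p + andrasfaiAdj i l q = (if j = l then 1 else 0) + 1 := by
  unfold andrasfaiAdj
  rcases hp with hp | hp <;> rcases hq with hq | hq <;> split_ifs <;> omega

/-- For generic `j` the hexagon contributes `2` and the three arcs `1`, in total `ω₀₀(v_j) = 3`. For
`j = 0` or `2i - 1` one arc, a whole block attached to the hexagon, has its sign flipped; this loses
`2` on exactly the block where the hexagon still contributes `2`, leaving `1`. -/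
theorem nbrSum_vegaInv_inner_inner (hi : 2 ≤ i) (j l : Fin (3 * i - 1)) :
    nbrSum i (vegaInv i (.inner j)) (.inner l) =
      (if VegaVertex.inner j = VegaVertex.inner l then 1 else 0) + omegaZero i (.inner j) := by
  obtain ⟨p, q, hp, hq⟩ := exists_shift hi j
  have hj := j.isLt
  have hl := l.isLt
  have key := andrasfaiAdj_triple hi hj hl p.isLt q.isLt hp hq
  have hsum : (∑ t : Fin (3 * i - 1), if i ≤ ((l : ℤ) - (t : ℤ)).natAbs ∧
      ((l : ℤ) - (t : ℤ)).natAbs ≤ 2 * i - 1 then vegaInv i (.inner j) (.inner t) else 0) =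
      andrasfaiAdj i l j + (if (j : ℕ) = 2 * i - 1 then -1 else 1) * andrasfaiAdj i l p +
        (if (j : ℕ) = 0 then -1 else 1) * andrasfaiAdj i l q :=
    sum_ite_deltas _ _ _ _ _ _ _ (vegaInv_inner_inner hi j p q hp hq)
  rw [nbrSum_inner, hsum]
  simp only [vegaInv, omegaZero, VegaVertex.inner.injEq, Fin.ext_iff]
  generalize (if (j : ℕ) = l then (1 : ℤ) else 0) = e at key ⊢
  by_cases hj0 : (j : ℕ) = 0
  · rw [show (q : ℕ) = 2 * i - 1 by omega, andrasfaiAdj_mid hi hl] at key ⊢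
    simp only [hj0, show ¬ 0 = 2 * i - 1 by omega, if_true, if_false, true_or] at key ⊢
    split_ifs at key ⊢ <;> omega
  · by_cases hj1 : (j : ℕ) = 2 * i - 1
    · rw [show (p : ℕ) = 0 by omega, andrasfaiAdj_zero] at key ⊢
      simp only [hj1, show ¬ 2 * i - 1 = 0 by omega, if_true, if_false, or_true] at key ⊢
      split_ifs at key ⊢ <;> omega
    · simp only [hj0, hj1, or_self, if_false, one_mul, key]
      split_ifs <;> omega

theorem nbrSum_vegaInv (hi : 2 ≤ i) (z t : VegaVertex i) :
    nbrSum i (vegaInv i z) t = (if z = t then 1 else 0) + omegaZero i z := by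
  cases z with
  | x | y =>
    rw [nbrSum_of_affine hi _ 0 0 0 (by intro j; simp [vegaInv])]
    cases t <;> simp [vegaInv, omegaZero]
  | a | u =>
    rw [nbrSum_of_affine hi _ 1 0 1 (by intro j; simp only [vegaInv]; split_ifs <;> simp)]
    cases t <;> simp only [vegaInv, omegaZero, reduceCtorEq, if_true, if_false] <;>
      (try split_ifs) <;> ring
  | b | v =>
    rw [nbrSum_of_affine hi _ 1 1 0 (by intro j; simp only [vegaInv]; split_ifs <;> simp)]
    cases t <;> simp only [vegaInv, omegaZero, reduceCtorEq, if_true, if_false] <;>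
      (try split_ifs) <;> ring
  | c | w =>
    rw [nbrSum_of_affine hi _ 1 1 1 (by intro j; simp only [vegaInv]; split_ifs <;> omega)]
    cases t <;> simp only [vegaInv, omegaZero, reduceCtorEq, if_true, if_false] <;>
      (try split_ifs) <;> ring
  | inner j =>
    obtain ⟨p, q, hp, hq⟩ := exists_shift hi j
    have hj := j.isLt
    have hF := vegaInv_inner_inner hi j p q hp hq
    cases t with
    | x => simp only [nbrSum_x, vegaInv, omegaZero]; split_ifs <;> first | omega | simp_all
    | y => simp only [nbrSum_y, vegaInv, omegaZero]; split_ifs <;> first | omega | simp_all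
    | a | b | c | u | v | w =>
      simp only [nbrSum_a, nbrSum_b, nbrSum_c, nbrSum_u, nbrSum_v, nbrSum_w]
      rw [sum_ite_deltas _ _ _ _ _ _ _ hF]
      simp only [vegaInv, omegaZero, reduceCtorEq, if_false]
      split_ifs <;> omega
    | inner l => exact nbrSum_vegaInv_inner_inner hi j l

end identities

/-! ### The entrywise bound `C_{μν} ≤ ω_{μν} ω_{μν}ᵀ` -/

section bounds
variable {i : ℕ}

/-- The vertices `a, b, c, u, v, w` of the hexagon. -/
def IsHex : VegaVertex i → Prop
  | .x | .y | .inner _ => False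
  | _ => True

/-- The vertices of weight one in `ω_{μν}`. -/
def IsLight (i : ℕ) (μ ν : Fin 2) (z : VegaVertex i) : Prop :=
  (μ = 0 ∧ (z = .x ∨ z = .y)) ∨
    (ν = 0 ∧ ∃ j : Fin (3 * i - 1), z = .inner j ∧ ((j : ℕ) = 0 ∨ (j : ℕ) = 2 * i - 1))

/-- The matrix `C_{μν} = C - μ f fᵀ - ν g gᵀ`. -/
def vegaInvDel (i : ℕ) (μ ν : Fin 2) (z t : VegaVertex i) : ℤ :=
  vegaInv i z t - ((μ : ℕ) : ℤ) * (f i z * f i t) - ((ν : ℕ) : ℤ) * (g i z * g i t)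

theorem vegaInvDel_comm (μ ν : Fin 2) (z t : VegaVertex i) :
    vegaInvDel i μ ν z t = vegaInvDel i μ ν t z := by
  rw [vegaInvDel, vegaInvDel, vegaInv_comm, mul_comm (f i z), mul_comm (g i z)]

theorem omega_of_isHex (μ ν : Fin 2) {z : VegaVertex i} (hz : IsHex z) :
    3 * (i : ℤ) - 4 ≤ omega i μ ν z := by
  obtain rfl | rfl : μ = 0 ∨ μ = 1 := by omega
  all_goals obtain rfl | rfl : ν = 0 ∨ ν = 1 := by omega
  all_goals cases z <;> simp [omega, omegaZero, f, g, IsHex] at hz ⊢ <;> omega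

theorem omega_pos (hi : 2 ≤ i) (μ ν : Fin 2) {z : VegaVertex i} (hz : z ∈ vegaVerts i μ ν) :
    1 ≤ omega i μ ν z := by
  cases z with
  | inner j =>
    obtain rfl | rfl : ν = 0 ∨ ν = 1 := by omega
    · simp only [omega, omegaZero, f, g, Fin.coe_ofNat_eq_mod]; split_ifs <;> omega
    · simp [vegaVerts] at hz
      simp [omega, omegaZero, f, g]; split_ifs <;> omega
  | x | y =>
    obtain rfl | rfl : μ = 0 ∨ μ = 1 := by omega
    all_goals simp [vegaVerts, omega, omegaZero, f, g] at hz ⊢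
  | a | b | c | u | v | w =>
    exact le_trans (by omega : (1 : ℤ) ≤ 3 * i - 4) (omega_of_isHex μ ν trivial)

theorem vegaInvDel_le_of_isHex (μ ν : Fin 2) {z t : VegaVertex i} (hz : IsHex z) (ht : IsHex t) :
    vegaInvDel i μ ν z t ≤ i := by
  have h : vegaInv i z t ≤ i := by
    cases z <;> simp only [IsHex] at hz <;> cases t <;> simp only [IsHex] at ht <;>
      simp only [vegaInv] <;> omega
  have hf : 0 ≤ f i z * f i t := by
    apply mul_nonneg
    · cases z <;> simp [IsHex, f] at hz ⊢
    · cases t <;> simp [IsHex, f] at ht ⊢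
  have hg : 0 ≤ g i z * g i t := by
    apply mul_nonneg
    · cases z <;> simp [IsHex, g] at hz ⊢
    · cases t <;> simp [IsHex, g] at ht ⊢
  have h1 := mul_nonneg (Nat.cast_nonneg' (α := ℤ) (μ : ℕ)) hf
  have h2 := mul_nonneg (Nat.cast_nonneg' (α := ℤ) (ν : ℕ)) hg
  simp only [vegaInvDel]
  omega

theorem vegaInvDel_le_one_of_isHex (μ ν : Fin 2) {z t : VegaVertex i} (hz : IsHex z)
    (ht : ¬ IsHex t) : vegaInvDel i μ ν z t ≤ 1 := by
  obtain rfl | rfl : μ = 0 ∨ μ = 1 := by omega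
  all_goals obtain rfl | rfl : ν = 0 ∨ ν = 1 := by omega
  all_goals
    cases t <;> simp [IsHex] at ht <;> cases z <;> simp [IsHex] at hz <;>
      simp [vegaInvDel, vegaInv, f, g] <;> split_ifs <;> omega

theorem vegaInvDel_inner_inner_lt (hi : 2 ≤ i) (μ ν : Fin 2) {j l : Fin (3 * i - 1)}
    (hj : .inner j ∈ vegaVerts i μ ν) (hl : .inner l ∈ vegaVerts i μ ν)
    (h : ¬ (j = l ∧ IsLight i μ ν (.inner j))) :
    vegaInvDel i μ ν (.inner j) (.inner l) <
      omega i μ ν (.inner j) * omega i μ ν (.inner l) := by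
  obtain rfl | rfl : ν = 0 ∨ ν = 1 := by omega
  · simp [IsLight] at h
    simp only [vegaInvDel, omega, vegaInv, omegaZero, f, g, Fin.coe_ofNat_eq_mod, Nat.zero_mod,
      Nat.cast_zero, zero_mul, mul_zero, sub_zero, Fin.ext_iff] at h ⊢
    split_ifs <;> omega
  · simp [vegaVerts] at hj hl
    simp only [vegaInvDel, omega, vegaInv, omegaZero, f, g, hj, hl, Fin.coe_ofNat_eq_mod,
      Nat.one_mod, Nat.cast_one, one_mul, mul_zero, sub_zero, Fin.ext_iff, or_false, and_false,
      if_false]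
    split_ifs <;> omega

theorem vegaInvDel_not_isHex_lt (hi : 2 ≤ i) (μ ν : Fin 2) {z t : VegaVertex i}
    (hz : z ∈ vegaVerts i μ ν) (ht : t ∈ vegaVerts i μ ν) (hz' : ¬ IsHex z) (ht' : ¬ IsHex t)
    (h : ¬ (z = t ∧ IsLight i μ ν z)) :
    vegaInvDel i μ ν z t < omega i μ ν z * omega i μ ν t := by
  have pz := omega_pos hi μ ν hz
  have pt := omega_pos hi μ ν ht
  have pp : 0 < omega i μ ν z * omega i μ ν t := mul_pos (by omega) (by omega)
  cases z <;> simp only [IsHex, not_true_eq_false] at hz' <;>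
    cases t <;> simp only [IsHex, not_true_eq_false] at ht'
  case inner.inner j l =>
    exact vegaInvDel_inner_inner_lt hi μ ν hz ht (by simpa using h)
  case x.inner | y.inner | inner.x | inner.y => simpa [vegaInvDel, vegaInv, f, g] using pp
  all_goals
    obtain rfl | rfl : μ = 0 ∨ μ = 1 := by omega
    all_goals simp [vegaVerts, IsLight, vegaInvDel, vegaInv, omega, omegaZero, f, g] at *

/-- Hexagon weights are at least `3i - 4 ≥ 2`, which beats the entries (at most `i` inside the
hexagon, at most `1` between it and the rest). Outside the hexagon the entries are small enough for
a direct check. -/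
theorem vegaInvDel_lt (hi : 2 ≤ i) (μ ν : Fin 2) {z t : VegaVertex i}
    (hz : z ∈ vegaVerts i μ ν) (ht : t ∈ vegaVerts i μ ν) (h : ¬ (z = t ∧ IsLight i μ ν z)) :
    vegaInvDel i μ ν z t < omega i μ ν z * omega i μ ν t := by
  have pz := omega_pos hi μ ν hz
  have pt := omega_pos hi μ ν ht
  by_cases hz' : IsHex z
  · have h1 := omega_of_isHex μ ν hz'
    by_cases ht' : IsHex t
    · have h2 := omega_of_isHex μ ν ht'
      have h3 := vegaInvDel_le_of_isHex μ ν hz' ht'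
      -- The bound `6i - 8` exceeds `i` because `i ≥ 2`.
      have h4 : 2 * (3 * (i : ℤ) - 4) ≤ omega i μ ν z * omega i μ ν t :=
        mul_le_mul (by omega) h2 (by omega) (by omega)
      omega
    · have h3 := vegaInvDel_le_one_of_isHex μ ν hz' ht'
      have h4 : 2 * 1 ≤ omega i μ ν z * omega i μ ν t :=
        mul_le_mul (by omega) pt (by omega) (by omega)
      omega
  · by_cases ht' : IsHex t
    · have h2 := omega_of_isHex μ ν ht'
      have h3 := vegaInvDel_le_one_of_isHex μ ν ht' hz'
      rw [vegaInvDel_comm] at h3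
      have h4 : 1 * 2 ≤ omega i μ ν z * omega i μ ν t :=
        mul_le_mul pz (by omega) (by omega) (by omega)
      omega
    · exact vegaInvDel_not_isHex_lt hi μ ν hz ht hz' ht' h

theorem IsLight.omega_eq {μ ν : Fin 2} {z : VegaVertex i} (h : IsLight i μ ν z) :
    omega i μ ν z = 1 := by
  rcases h with ⟨rfl, rfl | rfl⟩ | ⟨rfl, j, rfl, hj⟩
  · simp [omega, omegaZero, f, g]
  · simp [omega, omegaZero, f, g]
  · simp [omega, omegaZero, f, hj]

theorem IsLight.vegaInvDel_eq {μ ν : Fin 2} {z : VegaVertex i}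
    (h : IsLight i μ ν z) (t : VegaVertex i) : vegaInvDel i μ ν z t = vegaInv i z t := by
  rcases h with ⟨rfl, rfl | rfl⟩ | ⟨rfl, j, rfl, hj⟩ <;> simp [vegaInvDel, f, g]

theorem IsLight.vegaInv_self {μ ν : Fin 2} {z : VegaVertex i}
    (h : IsLight i μ ν z) : vegaInv i z z = 1 := by
  rcases h with ⟨rfl, rfl | rfl⟩ | ⟨rfl, j, rfl, hj⟩ <;> simp [vegaInv]

theorem notMem_vegaVerts {μ ν : Fin 2} {z : VegaVertex i} (h : z ∉ vegaVerts i μ ν) :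
    (μ = 1 ∧ z = .y) ∨ (ν = 1 ∧ ∃ j, z = .inner j ∧ (j : ℕ) = 2 * i - 1) := by
  by_contra hc
  exact h (not_or.mp hc)

theorem omega_of_notMem (hi : 2 ≤ i) {μ ν : Fin 2} {z : VegaVertex i}
    (h : z ∉ vegaVerts i μ ν) : omega i μ ν z = 0 := by
  rcases notMem_vegaVerts h with ⟨rfl, rfl⟩ | ⟨rfl, j, rfl, hj⟩
  · simp [omega, omegaZero, f, g]
  · simp [omega, omegaZero, f, g, hj]; omega

theorem vegaInv_y (t : VegaVertex i) : vegaInv i .y t = f i t := by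
  cases t <;> rfl

theorem vegaInv_mid (hi : 2 ≤ i) {j : Fin (3 * i - 1)} (hj : (j : ℕ) = 2 * i - 1)
    (t : VegaVertex i) : vegaInv i (.inner j) t = g i t := by
  cases t with
  | inner l =>
    have := l.isLt
    simp only [vegaInv, g, hj, Fin.ext_iff, and_true]; split_ifs <;> omega
  | _ => simp [vegaInv, g, hj] <;> omega

/-- The rank-one corrections are chosen for this: `f` and `g` are the rows of `C` at `y` and
`v_{2i-1}`, each is `1` at its own vertex and `0` at the other. -/
theorem vegaInvDel_of_notMem (hi : 2 ≤ i) {μ ν : Fin 2} {z : VegaVertex i}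
    (h : z ∉ vegaVerts i μ ν) (t : VegaVertex i) : vegaInvDel i μ ν z t = 0 := by
  rcases notMem_vegaVerts h with ⟨rfl, rfl⟩ | ⟨rfl, j, rfl, hj⟩
  · simp [vegaInvDel, vegaInv_y, f, g]
  · rw [vegaInvDel, vegaInv_mid hi hj]
    have hg : g i (.inner j) = 1 := by simp only [g, hj, or_true, if_true]; split_ifs <;> omega
    simp [f, hg]

theorem vegaInvDel_le (hi : 2 ≤ i) (μ ν : Fin 2) (z t : VegaVertex i) :
    vegaInvDel i μ ν z t ≤ omega i μ ν z * omega i μ ν t := by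
  by_cases hz : z ∈ vegaVerts i μ ν
  · by_cases ht : t ∈ vegaVerts i μ ν
    · by_cases h : z = t ∧ IsLight i μ ν z
      · obtain ⟨rfl, h⟩ := h
        rw [h.vegaInvDel_eq, h.omega_eq, h.vegaInv_self, one_mul]
      · exact (vegaInvDel_lt hi μ ν hz ht h).le
    · rw [vegaInvDel_comm, vegaInvDel_of_notMem hi ht, omega_of_notMem hi ht, mul_zero]
  · rw [vegaInvDel_of_notMem hi hz, omega_of_notMem hi hz, zero_mul]

end bounds

/-! ### From the defect to the weight functions -/

section core
variable {i : ℕ}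

theorem sum_omegaZero (hi : 2 ≤ i) : ∑ z, omegaZero i z = 27 * i - 19 := by
  have h := sum_ite_affine (fun _ : Fin (3 * i - 1) => True) (fun j => omegaZero i (.inner j)) 3 2 2
    ⟨0, by omega⟩ ⟨2 * i - 1, by omega⟩
    (by intro j; simp only [omegaZero, Fin.ext_iff]; split_ifs <;> omega)
  simp only [if_true, sum_const, card_univ, Fintype.card_fin, nsmul_eq_mul, mul_one] at h
  rw [sum_vegaVertex, h]
  simp only [omegaZero]
  omega

/-- Pairing row `z` of `C` with `A ω₀₀ = K 𝟙`, where `K = 9i - 6`, gives `K` times the row sum as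
`ω₀₀(z) + (3K - 1) ω₀₀(z)`. -/
theorem sum_vegaInv (hi : 2 ≤ i) (z : VegaVertex i) : ∑ t, vegaInv i z t = 3 * omegaZero i z := by
  have h := sum_mul_nbrSum_comm (vegaInv i z) (omegaZero i)
  simp only [nbrSum_omegaZero hi, nbrSum_vegaInv hi, mul_add, sum_add_distrib, ← sum_mul,
    sum_omegaZero hi, mul_ite, mul_one, mul_zero, sum_ite_eq, mem_univ, if_true] at h
  have hK : (9 * (i : ℤ) - 6) ≠ 0 := by omega
  apply mul_right_cancel₀ hK
  rw [h]; ring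

/-- The defect of a weight function: how far the neighbourhood of `z` is from having weight `s`. -/
noncomputable def defect (i : ℕ) (h : VegaVertex i → ℤ) (s : ℤ) (z : VegaVertex i) : ℤ :=
  s - nbrSum i h z

theorem eq_sub_sum_vegaInv_mul_defect (hi : 2 ≤ i) (h : VegaVertex i → ℤ) (s : ℤ)
    (z : VegaVertex i) :
    h z = (3 * s - ∑ t, h t) * omegaZero i z - ∑ t, vegaInv i z t * defect i h s t := by
  have e := sum_mul_nbrSum_comm (vegaInv i z) h
  simp only [nbrSum_vegaInv hi, mul_add, sum_add_distrib, ← sum_mul, mul_ite, mul_one, mul_zero,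
    sum_ite_eq, mem_univ, if_true] at e
  simp only [defect, mul_sub, sum_sub_distrib, ← sum_mul, sum_vegaInv hi, e]
  ring

theorem sum_omegaZero_mul_defect (hi : 2 ≤ i) (h : VegaVertex i → ℤ) (s : ℤ) :
    ∑ t, omegaZero i t * defect i h s t = (27 * i - 19) * s - (9 * i - 6) * ∑ t, h t := by
  have e := sum_mul_nbrSum_comm (omegaZero i) h
  simp only [nbrSum_omegaZero hi, ← sum_mul] at e
  simp only [defect, mul_sub, sum_sub_distrib, ← sum_mul, sum_omegaZero hi, e]
  ring

/-- Each deletion subtracts `3s - n` from `(3k - 1)s - kn`, which amounts to lowering `k` by one. -/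
theorem sum_omega_mul_defect (hi : 2 ≤ i) (μ ν : Fin 2) (h : VegaVertex i → ℤ) (s : ℤ)
    (hμ : μ = 1 → ∑ t, f i t * defect i h s t = 3 * s - ∑ t, h t)
    (hν : ν = 1 → ∑ t, g i t * defect i h s t = 3 * s - ∑ t, h t) :
    ∑ t, omega i μ ν t * defect i h s t = (3 * (9 * i - 6 - (μ : ℕ) - (ν : ℕ)) - 1) * s
      - (9 * i - 6 - (μ : ℕ) - (ν : ℕ)) * ∑ t, h t := by
  simp only [omega, sub_mul, sum_sub_distrib, mul_assoc, ← mul_sum, sum_omegaZero_mul_defect hi]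
  obtain rfl | rfl : μ = 0 ∨ μ = 1 := by omega
  all_goals obtain rfl | rfl : ν = 0 ∨ ν = 1 := by omega
  all_goals simp [hμ, hν]
  all_goals ring

/-- This is the representation of `h` read at `y`, where `ω₀₀` is `1` and the row of `C` is `f`. -/
theorem sum_f_mul_defect (hi : 2 ≤ i) (h : VegaVertex i → ℤ) (s : ℤ) (hy : h .y = 0) :
    ∑ t, f i t * defect i h s t = 3 * s - ∑ t, h t := by
  have e := eq_sub_sum_vegaInv_mul_defect hi h s .y
  simp only [hy, vegaInv_y, omegaZero] at e
  omega

theorem sum_g_mul_defect (hi : 2 ≤ i) (h : VegaVertex i → ℤ) (s : ℤ)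
    (hm : ∀ j : Fin (3 * i - 1), (j : ℕ) = 2 * i - 1 → h (.inner j) = 0) :
    ∑ t, g i t * defect i h s t = 3 * s - ∑ t, h t := by
  have e := eq_sub_sum_vegaInv_mul_defect hi h s (.inner ⟨2 * i - 1, by omega⟩)
  rw [hm _ rfl] at e
  simp only [vegaInv_mid hi, omegaZero, or_true, if_true] at e
  omega

theorem eq_sub_sum_vegaInvDel_mul_defect (hi : 2 ≤ i) (μ ν : Fin 2) (h : VegaVertex i → ℤ) (s : ℤ)
    (hμ : μ = 1 → ∑ t, f i t * defect i h s t = 3 * s - ∑ t, h t)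
    (hν : ν = 1 → ∑ t, g i t * defect i h s t = 3 * s - ∑ t, h t) (z : VegaVertex i) :
    h z = (3 * s - ∑ t, h t) * omega i μ ν z - ∑ t, vegaInvDel i μ ν z t * defect i h s t := by
  have e := eq_sub_sum_vegaInv_mul_defect hi h s z
  have e' : ∑ t, vegaInvDel i μ ν z t * defect i h s t = ∑ t, vegaInv i z t * defect i h s t
      - (μ : ℕ) * f i z * ∑ t, f i t * defect i h s t
      - (ν : ℕ) * g i z * ∑ t, g i t * defect i h s t := by
    simp only [vegaInvDel, sub_mul, sum_sub_distrib, mul_sum, mul_assoc]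
  rw [e', omega]
  obtain rfl | rfl : μ = 0 ∨ μ = 1 := by omega
  all_goals obtain rfl | rfl : ν = 0 ∨ ν = 1 := by omega
  all_goals simp [hμ, hν]
  all_goals linear_combination e

/-- The difference of the two sides of `hsum` is a sum of nonnegative terms, so each vanishes; where
the matrix bound is strict, this forces the product to vanish. -/
theorem defect_mul_defect_eq_zero (hi : 2 ≤ i) (μ ν : Fin 2) (d : VegaVertex i → ℤ)
    (hd : ∀ z, 0 ≤ d z)
    (hsum : ∑ z, d z * ∑ t, vegaInvDel i μ ν z t * d t = (∑ z, omega i μ ν z * d z) ^ 2)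
    {z t : VegaVertex i} (hz : z ∈ vegaVerts i μ ν) (ht : t ∈ vegaVerts i μ ν)
    (h : ¬ (z = t ∧ IsLight i μ ν z)) : d z * d t = 0 := by
  have e : ∑ z, ∑ t, (omega i μ ν z * omega i μ ν t - vegaInvDel i μ ν z t) * (d z * d t) = 0 := by
    rw [← sub_eq_zero] at hsum
    rw [← neg_eq_zero, ← hsum, sq, sum_mul_sum]
    simp only [mul_sum, ← sum_sub_distrib, ← sum_neg_distrib]
    refine sum_congr rfl fun z _ => sum_congr rfl fun t _ => by ring
  have hnn : ∀ z t, 0 ≤ (omega i μ ν z * omega i μ ν t - vegaInvDel i μ ν z t) * (d z * d t) :=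
    fun z t => mul_nonneg (sub_nonneg.2 (vegaInvDel_le hi μ ν z t)) (mul_nonneg (hd z) (hd t))
  rw [sum_eq_zero_iff_of_nonneg (fun z _ => sum_nonneg fun t _ => hnn z t)] at e
  have e1 := e z (mem_univ z)
  rw [sum_eq_zero_iff_of_nonneg (fun t _ => hnn z t)] at e1
  have e2 := e1 t (mem_univ t)
  have := vegaInvDel_lt hi μ ν hz ht h
  exact (mul_eq_zero.1 e2).resolve_left (by omega)

/-- The possible weight functions when the edge bound is attained. -/
theorem weights_of_sum_mul_defect (hi : 2 ≤ i) (μ ν : Fin 2) (h : VegaVertex i → ℤ) (n s l : ℤ)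
    (hn : ∑ t, h t = n)
    (hl : l = (3 * (9 * i - 6 - (μ : ℕ) - (ν : ℕ)) - 1) * s - (9 * i - 6 - (μ : ℕ) - (ν : ℕ)) * n)
    (hh : ∀ z, 0 ≤ h z) (hd : ∀ z, 0 ≤ defect i h s z) (hdel : ∀ z ∉ vegaVerts i μ ν, h z = 0)
    (he : ∑ z, h z * defect i h s z = l * (3 * s - n - l)) :
    (l = 0 ∧ ∀ z, h z = (3 * s - n) * omega i μ ν z) ∨
      (0 < l ∧ l ≤ 3 * s - n ∧ ∃ z, IsLight i μ ν z ∧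
        ∀ t, h t = (3 * s - n) * omega i μ ν t - l * vegaInv i z t) := by
  subst hn
  have hμ : μ = 1 → ∑ t, f i t * defect i h s t = 3 * s - ∑ t, h t := fun hm =>
    sum_f_mul_defect hi h s (hdel _ fun hc => hc.1 ⟨hm, rfl⟩)
  have hν : ν = 1 → ∑ t, g i t * defect i h s t = 3 * s - ∑ t, h t := fun hm =>
    sum_g_mul_defect hi h s fun j hj => hdel _ fun hc => hc.2 ⟨hm, j, rfl, hj⟩
  have hlam := (sum_omega_mul_defect hi μ ν h s hμ hν).trans hl.symm
  have hrep := eq_sub_sum_vegaInvDel_mul_defect hi μ ν h s hμ hν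
  -- From here on only `d ≥ 0`, `ω_{μν}·d = λ`, `h·d` and the representation of `h` matter.
  generalize defect i h s = d at *
  have hnn : 0 ≤ l * (3 * s - ∑ t, h t - l) :=
    he ▸ sum_nonneg fun z _ => mul_nonneg (hh z) (hd z)
  have hquad : ∑ z, d z * ∑ t, vegaInvDel i μ ν z t * d t = (∑ z, omega i μ ν z * d z) ^ 2 := by
    have e : ∑ z, h z * d z = (3 * s - ∑ t, h t) * (∑ z, omega i μ ν z * d z)
        - ∑ z, d z * ∑ t, vegaInvDel i μ ν z t * d t := by
      rw [mul_sum, ← sum_sub_distrib]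
      refine sum_congr rfl fun z _ => ?_
      rw [hrep z]; ring
    rw [he, hlam] at e
    rw [hlam]
    linear_combination e
  have hprod := fun {z t} => @defect_mul_defect_eq_zero i hi μ ν d hd hquad z t
  by_cases h0 : ∀ z ∈ vegaVerts i μ ν, d z = 0
  · left
    constructor
    · rw [← hlam]
      refine sum_eq_zero fun z _ => ?_
      by_cases hz : z ∈ vegaVerts i μ ν
      · rw [h0 z hz, mul_zero]
      · rw [omega_of_notMem hi hz, zero_mul]
    · intro z
      rw [hrep z, sub_eq_self]
      refine sum_eq_zero fun t _ => ?_
      by_cases ht : t ∈ vegaVerts i μ ν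
      · rw [h0 t ht, mul_zero]
      · rw [vegaInvDel_comm, vegaInvDel_of_notMem hi ht, zero_mul]
  · right
    push Not at h0
    obtain ⟨z, hz, hdz⟩ := h0
    -- At a remaining vertex that is not light the diagonal bound is strict, so `d z * d z = 0`.
    have hlight : IsLight i μ ν z := by
      by_contra hc
      exact hdz (mul_self_eq_zero.1 (hprod hz hz (fun hh => hc hh.2)))
    have hoth : ∀ t ∈ vegaVerts i μ ν, t ≠ z → d t = 0 := fun t ht htz =>
      (mul_eq_zero.1 (hprod hz ht (fun hh => htz hh.1.symm))).resolve_left hdz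
    have hl' : l = d z := by
      rw [← hlam, sum_eq_single z, hlight.omega_eq, one_mul]
      · intro t _ htz
        by_cases ht : t ∈ vegaVerts i μ ν
        · rw [hoth t ht htz, mul_zero]
        · rw [omega_of_notMem hi ht, zero_mul]
      · simp
    have hpos : 0 < l := hl' ▸ lt_of_le_of_ne (hd z) (Ne.symm hdz)
    refine ⟨hpos, ?_, z, hlight, fun t => ?_⟩
    · have := nonneg_of_mul_nonneg_right hnn hpos
      omega
    · have hsum : ∑ r, vegaInvDel i μ ν t r * d r = vegaInvDel i μ ν t z * d z := by
        refine sum_eq_single z (fun r _ hrz => ?_) (by simp)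
        by_cases hr : r ∈ vegaVerts i μ ν
        · rw [hoth r hr hrz, mul_zero]
        · rw [vegaInvDel_comm, vegaInvDel_of_notMem hi hr, zero_mul]
      have := hrep t
      rwa [hsum, vegaInvDel_comm, hlight.vegaInvDel_eq, ← hl', mul_comm _ l] at this

end core

/-! ### Triangle-freeness, and isomorphisms of blow-ups -/

theorem andrasfai_adj {i : ℕ} (p q : Fin (3 * i - 1)) :
    (andrasfai i).Adj p q ↔
      i ≤ ((p : ℤ) - (q : ℤ)).natAbs ∧ ((p : ℤ) - (q : ℤ)).natAbs ≤ 2 * i - 1 :=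
  Iff.rfl

theorem vega_triangle_free {i : ℕ} (hi : 2 ≤ i) {z p q : VegaVertex i} (hp : (vega i).Adj z p)
    (hq : (vega i).Adj z q) : ¬ (vega i).Adj p q := by
  simp only [vega_adj] at hp hq ⊢
  cases z <;> cases p <;>
    simp only [vegaRel, andrasfai_adj, ne_eq, reduceCtorEq, not_false_eq_true, true_and, or_false,
      false_or, or_true, and_true, not_true_eq_false, or_self, and_false] at hp <;>
    cases q <;>
    simp only [vegaRel, andrasfai_adj, ne_eq, reduceCtorEq, not_false_eq_true, true_and, or_false,
      false_or, or_true, and_true, not_true_eq_false, or_self, and_false] at hq ⊢ <;>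
    omega

section isomorphisms
variable {α β : Type} {F : SimpleGraph α} {F' : SimpleGraph β}

/-- An isomorphism of graphs that respects class sizes extends to the blow-ups. -/
def blowUpCongr {h : α → ℕ} {h' : β → ℕ} (σ : F ≃g F') (hh : ∀ z, h z = h' (σ z)) :
    blowUp F h ≃g blowUp F' h' where
  toEquiv := Equiv.sigmaCongr σ.toEquiv fun z => finCongr (hh z)
  map_rel_iff' {p q} := σ.map_rel_iff (a := p.1) (b := q.1)

/-- A constant blow-up of a blow-up is a blow-up. -/
def blowUpBlowUp {w h : α → ℕ} {m : ℕ} (hh : ∀ z, h z = w z * m) :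
    blowUp F h ≃g blowUp (blowUp F w) fun _ => m where
  toEquiv := ((Equiv.sigmaAssoc _).trans (Equiv.sigmaCongrRight fun z =>
    (Equiv.sigmaEquivProd _ _).trans (finProdFinEquiv.trans (finCongr (hh z).symm)))).symm
  map_rel_iff' := Iff.rfl

end isomorphisms

/-! ### Two involutions of `Υ_i`, carrying `x` to `y` and `v_0` to `v_{2i-1}` -/

section automorphisms
variable {i : ℕ}

/-- The automorphism of `Υ_i` exchanging `x, a, b, c` with `y, u, v, w`. -/
def swapFun : VegaVertex i → VegaVertex i
  | .x => .y | .y => .x | .a => .u | .u => .a | .b => .v | .v => .b | .c => .w | .w => .c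
  | .inner j => .inner j

/-- The reflection of `Γ_i` exchanging `v_0` and `v_{2i-1}`. -/
def reflectFin (j : Fin (3 * i - 1)) : Fin (3 * i - 1) :=
  ⟨if (j : ℕ) ≤ 2 * i - 1 then 2 * i - 1 - j else 5 * i - 2 - j, by
    have := j.isLt; split_ifs <;> omega⟩

/-- The automorphism of `Υ_i` that reflects `Γ_i` and exchanges `a, u` with `b, v`. -/
def reflectFun : VegaVertex i → VegaVertex i
  | .x => .x | .y => .y | .a => .b | .b => .a | .u => .v | .v => .u | .c => .c | .w => .w
  | .inner j => .inner (reflectFin j)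

theorem swapFun_involutive : Function.Involutive (swapFun (i := i)) := by
  intro z; cases z <;> rfl

theorem reflectFun_involutive : Function.Involutive (reflectFun (i := i)) := by
  intro z
  cases z with
  | inner j =>
    have := j.isLt
    simp only [reflectFun, reflectFin, VegaVertex.inner.injEq, Fin.ext_iff]
    split_ifs <;> omega
  | _ => rfl

theorem vega_adj_iff_of_involutive {σ : VegaVertex i → VegaVertex i} (hσ : Function.Involutive σ)
    (h : ∀ z t, (vega i).Adj z t → (vega i).Adj (σ z) (σ t)) (z t : VegaVertex i) :
    (vega i).Adj (σ z) (σ t) ↔ (vega i).Adj z t :=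
  ⟨fun hz => by simpa only [hσ z, hσ t] using h _ _ hz, h z t⟩

theorem swapFun_adj (z t : VegaVertex i) :
    (vega i).Adj (swapFun z) (swapFun t) ↔ (vega i).Adj z t := by
  refine vega_adj_iff_of_involutive swapFun_involutive (fun z t h => ?_) z t
  cases z <;> cases t <;> simp_all [vega_adj, vegaRel, swapFun]

theorem reflectFun_adj (hi : 2 ≤ i) (z t : VegaVertex i) :
    (vega i).Adj (reflectFun z) (reflectFun t) ↔ (vega i).Adj z t := by
  refine vega_adj_iff_of_involutive reflectFun_involutive (fun z t h => ?_) z t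
  cases z with
  | inner j =>
    have hj := j.isLt
    cases t with
    | inner l =>
      have hl := l.isLt
      simp only [reflectFun, reflectFin, vega_adj_inner] at h ⊢
      split_ifs <;> omega
    | _ =>
      simp [vega_adj, vegaRel, reflectFun, reflectFin] at h ⊢ <;> split_ifs <;> omega
  | _ =>
    cases t with
    | inner l =>
      have hl := l.isLt
      simp [vega_adj, vegaRel, reflectFun, reflectFin] at h ⊢ <;> split_ifs <;> omega
    | _ => simp [vega_adj, vegaRel, reflectFun] at h ⊢

/-- An involutive automorphism of `Υ_i` that fixes the set of deleted vertices. -/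
def vegaDelIso {μ ν : Fin 2} {σ : VegaVertex i → VegaVertex i} (hσ : Function.Involutive σ)
    (hadj : ∀ z t, (vega i).Adj (σ z) (σ t) ↔ (vega i).Adj z t)
    (hv : ∀ z, z ∈ vegaVerts i μ ν ↔ σ z ∈ vegaVerts i μ ν) :
    vegaDel i μ ν ≃g vegaDel i μ ν where
  toEquiv := (hσ.toPerm σ).subtypeEquiv hv
  map_rel_iff' {p q} := hadj p q

theorem swapFun_mem (ν : Fin 2) (z : VegaVertex i) :
    z ∈ vegaVerts i 0 ν ↔ swapFun z ∈ vegaVerts i 0 ν := by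
  cases z <;> simp [vegaVerts, swapFun]

theorem reflectFun_mem (μ : Fin 2) (z : VegaVertex i) :
    z ∈ vegaVerts i μ 0 ↔ reflectFun z ∈ vegaVerts i μ 0 := by
  cases z <;> simp [vegaVerts, reflectFun]

theorem omega_swapFun (ν : Fin 2) (z : VegaVertex i) :
    omega i 0 ν (swapFun z) = omega i 0 ν z := by
  cases z <;> simp [omega, omegaZero, g, swapFun]

theorem omega_reflectFun (hi : 2 ≤ i) (μ : Fin 2) (z : VegaVertex i) :
    omega i μ 0 (reflectFun z) = omega i μ 0 z := by
  cases z with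
  | inner j =>
    have := j.isLt
    simp only [omega, omegaZero, f, reflectFun, reflectFin, Fin.coe_ofNat_eq_mod, Nat.zero_mod,
      Nat.cast_zero, zero_mul]
    split_ifs <;> omega
  | _ => simp [omega, omegaZero, f, reflectFun]

theorem vegaInv_x (t : VegaVertex i) : vegaInv i .x t = f i (swapFun t) := by
  cases t <;> rfl

theorem vegaInv_zero (hi : 2 ≤ i) {j : Fin (3 * i - 1)} (hj : (j : ℕ) = 0)
    (t : VegaVertex i) : vegaInv i (.inner j) t = g i (reflectFun t) := by
  cases t with
  | inner l =>
    have := l.isLt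
    simp only [vegaInv, g, reflectFun, reflectFin, hj, Fin.ext_iff, true_and]
    split_ifs <;> omega
  | _ => simp [vegaInv, g, reflectFun, hj] <;> omega

end automorphisms

/-! ### Class sizes, edge count and independence number -/

section coloured
variable {V : Type*} [Fintype V] {i : ℕ}

/-- The number of vertices of colour `z`. -/
def classSize (c : V → VegaVertex i) (z : VegaVertex i) : ℤ :=
  #{v | c v = z}

theorem sum_comp_eq_sum_classSize (c : V → VegaVertex i) (F : VegaVertex i → ℤ) :
    ∑ v, F (c v) = ∑ z, classSize c z * F z := by
  rw [← sum_fiberwise univ c]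
  refine sum_congr rfl fun z _ => ?_
  rw [sum_congr rfl (g := fun _ => F z) (by intro v hv; rw [(mem_filter.1 hv).2]), sum_const,
    nsmul_eq_mul, classSize]

theorem sum_classSize (c : V → VegaVertex i) : ∑ z, classSize c z = Fintype.card V := by
  simpa using (sum_comp_eq_sum_classSize c fun _ => 1).symm

open scoped Classical in
theorem card_filter_adj (c : V → VegaVertex i) (z : VegaVertex i) :
    (#{w | (vega i).Adj z (c w)} : ℤ) = nbrSum i (classSize c) z := by
  rw [← sum_boole, sum_comp_eq_sum_classSize c fun t => if (vega i).Adj z t then 1 else 0, nbrSum]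
  exact sum_congr rfl fun t _ => by rw [mul_ite, mul_one, mul_zero]

theorem two_mul_card_edgeFinset (H : SimpleGraph V) [Fintype H.edgeSet] (c : V → VegaVertex i)
    (hc : ∀ v w, H.Adj v w ↔ (vega i).Adj (c v) (c w)) :
    2 * (#H.edgeFinset : ℤ) = ∑ z, classSize c z * nbrSum i (classSize c) z := by
  classical
  have h := H.sum_degrees_eq_twice_card_edges
  rw [← sum_comp_eq_sum_classSize]
  have h2 : ∀ v, (H.degree v : ℤ) = nbrSum i (classSize c) (c v) := by
    intro v
    rw [← card_filter_adj, SimpleGraph.degree, SimpleGraph.neighborFinset_eq_filter]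
    simp only [hc]
  rw [← sum_congr rfl fun v _ => h2 v]
  have hE : #H.edgeFinset = #(@SimpleGraph.edgeFinset V H H.fintypeEdgeSet) := by congr!
  rw [hE]
  exact_mod_cast h.symm

/-- The vertices coloured by neighbours of `z` form an independent set, even if no vertex has colour
`z`; so the defect is nonnegative at empty and deleted classes too. -/
theorem nbrSum_classSize_le (hi : 2 ≤ i) (H : SimpleGraph V) (c : V → VegaVertex i)
    (hc : ∀ v w, H.Adj v w ↔ (vega i).Adj (c v) (c w)) (z : VegaVertex i) :
    nbrSum i (classSize c) z ≤ H.indepNum := by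
  classical
  rw [← card_filter_adj]
  refine Int.ofNat_le.2 (SimpleGraph.IsIndepSet.card_le_indepNum ?_)
  intro v hv w hw _
  rw [hc]
  exact vega_triangle_free hi (by simpa using hv) (by simpa using hw)

end coloured

/-! ### Translation to the family `ℋ^n_k(s)` -/

section conclusion
variable {V : Type*} {i : ℕ} {μ ν : Fin 2}

theorem card_fiber_blowUp [Fintype V] {H : SimpleGraph V} {h : vegaVerts i μ ν → ℕ}
    (e : H ≃g blowUp (vegaDel i μ ν) h) (z : vegaVerts i μ ν) :
    classSize (fun v => ((e v).1 : VegaVertex i)) z = h z := by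
  classical
  rw [classSize]
  congr 1
  rw [← Fintype.card_subtype, ← Fintype.card_fin (h z)]
  refine Fintype.card_congr (((e.toEquiv.subtypeEquiv fun v => ?_) :
    {v : V // ((e v).1 : VegaVertex i) = z} ≃ {p : Σ t, Fin (h t) // p.1 = z}).trans
    (Equiv.sigmaSubtype z))
  exact Subtype.ext_iff.symm

/-- The alternatives for the class sizes. -/
def ExtremalWeights (i k n s : ℕ) (μ ν : Fin 2) (h : vegaVerts i μ ν → ℕ) : Prop :=
  ((s : ℚ) = k * n / (3 * k - 1) ∧ ∀ z, (h z : ℤ) = (3 * (s : ℤ) - n) * omega i μ ν z) ∨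
    ((k : ℚ) * n / (3 * k - 1) < s ∧ (s : ℚ) ≤ (k - 1) * n / (3 * k - 4) ∧
      ((μ = 0 ∧ ∀ z, (h z : ℤ) = (3 * (s : ℤ) - n) * omega i μ ν z - lam k n s * f i z) ∨
        (ν = 0 ∧ ∀ z, (h z : ℤ) = (3 * (s : ℤ) - n) * omega i μ ν z - lam k n s * g i z)))

theorem ExtremalWeights.exists_family {k n s : ℕ} (hi : 2 ≤ i)
    (hk : k = 9 * i - (6 + (μ : ℕ) + (ν : ℕ))) {H : SimpleGraph V} {h : vegaVerts i μ ν → ℕ}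
    (e : H ≃g blowUp (vegaDel i μ ν) h) (hw : ExtremalWeights i k n s μ ν h) :
    ∃ (W : Type) (G : SimpleGraph W), ExtremalFamily n k s W G ∧ Nonempty (H ≃g G) := by
  rcases hw with ⟨hs, hh⟩ | ⟨hs, hs', ⟨rfl, hh⟩ | ⟨rfl, hh⟩⟩
  · refine ⟨_, _, .balanced i μ ν hi hk hs, ⟨e.trans (blowUpBlowUp fun z => ?_)⟩⟩
    have hk1 : 1 ≤ k := by omega
    -- Needed because the balanced graphs are blown up by the truncated difference `3 * s - n`; it
    -- follows from `kn = (3k - 1)s ≤ 3ks`.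
    have hns : n ≤ 3 * s := by
      have hk' : (1 : ℚ) ≤ k := by exact_mod_cast hk1
      rw [eq_div_iff (by linarith)] at hs
      have : (k : ℚ) * n ≤ k * (3 * s) := by
        have : (0 : ℚ) ≤ s := Nat.cast_nonneg s
        linarith
      exact_mod_cast le_of_mul_le_mul_left this (by linarith)
    have hpos := omega_pos hi μ ν z.2
    zify [hns]
    rw [hh z, Int.toNat_of_nonneg (by omega), mul_comm]
  · exact ⟨_, _, .alongF i ν hi (by simpa using hk) hs hs' h hh, ⟨e⟩⟩
  · exact ⟨_, _, .alongG i μ hi (by simpa using hk) hs hs' h hh, ⟨e⟩⟩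

theorem exists_extremalWeights {k n s : ℕ} (hi : 2 ≤ i) (hk10 : 10 ≤ k)
    {H : SimpleGraph V} {h : vegaVerts i μ ν → ℕ} (e : H ≃g blowUp (vegaDel i μ ν) h)
    (hw : (lam k n s = 0 ∧ ∀ z, (h z : ℤ) = (3 * (s : ℤ) - n) * omega i μ ν z) ∨
      (0 < lam k n s ∧ lam k n s ≤ 3 * (s : ℤ) - n ∧ ∃ z, IsLight i μ ν z ∧
        ∀ t, (h t : ℤ) = (3 * (s : ℤ) - n) * omega i μ ν t - lam k n s * vegaInv i z t)) :
    ∃ h' : vegaVerts i μ ν → ℕ, Nonempty (H ≃g blowUp (vegaDel i μ ν) h') ∧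
      ExtremalWeights i k n s μ ν h' := by
  have hk' : (10 : ℚ) ≤ k := by exact_mod_cast hk10
  rcases hw with ⟨hl, hh⟩ | ⟨hl, hle, z, hz, hh⟩
  · refine ⟨h, ⟨e⟩, .inl ⟨?_, hh⟩⟩
    rw [eq_div_iff (by linarith)]
    have : ((lam k n s : ℤ) : ℚ) = 0 := by exact_mod_cast hl
    simp only [lam] at this
    push_cast at this
    linarith
  have h1 : (k : ℚ) * n / (3 * k - 1) < s := by
    rw [div_lt_iff₀ (by linarith)]
    have : (0 : ℚ) < ((lam k n s : ℤ) : ℚ) := by exact_mod_cast hl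
    simp only [lam] at this
    push_cast at this
    linarith
  -- This upper bound on `s` is `λ ≤ 3s - n` rearranged.
  have h2 : (s : ℚ) ≤ (k - 1) * n / (3 * k - 4) := by
    rw [le_div_iff₀ (by linarith)]
    have : ((lam k n s : ℤ) : ℚ) ≤ ((3 * (s : ℤ) - n : ℤ) : ℚ) := by exact_mod_cast hle
    simp only [lam] at this
    push_cast at this
    linarith
  -- The light vertices are `x`, `y`, `v_0`, `v_{2i-1}`. At `y` and `v_{2i-1}` the row of `C` is `f`
  -- or `g` itself; at `x` and `v_0` it is so after composing `h` with the swap or the reflection.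
  rcases hz with ⟨rfl, rfl | rfl⟩ | ⟨rfl, j, rfl, hj | hj⟩
  · have hv := swapFun_mem (i := i) ν
    refine ⟨fun t => h ⟨swapFun t, (hv t).1 t.2⟩,
      ⟨e.trans (blowUpCongr (vegaDelIso swapFun_involutive swapFun_adj hv) fun t => ?_)⟩,
      .inr ⟨h1, h2, .inl ⟨rfl, fun t => ?_⟩⟩⟩
    · exact congrArg h (Subtype.ext (swapFun_involutive (t : VegaVertex i)).symm)
    · rw [hh, vegaInv_x, omega_swapFun, swapFun_involutive]
  · exact ⟨h, ⟨e⟩, .inr ⟨h1, h2, .inl ⟨rfl, fun t => by rw [hh, vegaInv_y]⟩⟩⟩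
  · have hv := reflectFun_mem (i := i) μ
    refine ⟨fun t => h ⟨reflectFun t, (hv t).1 t.2⟩,
      ⟨e.trans (blowUpCongr (vegaDelIso reflectFun_involutive (reflectFun_adj hi) hv)
        fun t => ?_)⟩, .inr ⟨h1, h2, .inr ⟨rfl, fun t => ?_⟩⟩⟩
    · exact congrArg h (Subtype.ext (reflectFun_involutive (t : VegaVertex i)).symm)
    · rw [hh, vegaInv_zero hi hj, omega_reflectFun hi, reflectFun_involutive]
  · exact ⟨h, ⟨e⟩, .inr ⟨h1, h2, .inr ⟨rfl, fun t => by rw [hh, vegaInv_mid hi hj]⟩⟩⟩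

theorem exists_weights_of_card_edgeFinset [Fintype V] {k n s : ℕ} (hi : 2 ≤ i) (hk : k = 9 * i - (6 + (μ : ℕ) + (ν : ℕ)))
    (H : SimpleGraph V) [Fintype H.edgeSet] {h : vegaVerts i μ ν → ℕ}
    (e : H ≃g blowUp (vegaDel i μ ν) h) (hn : Fintype.card V = n) (hα : H.indepNum ≤ s)
    (he : (H.edgeFinset.card : ℚ) = edgeBound k n s) :
    (lam k n s = 0 ∧ ∀ z, (h z : ℤ) = (3 * (s : ℤ) - n) * omega i μ ν z) ∨
      (0 < lam k n s ∧ lam k n s ≤ 3 * (s : ℤ) - n ∧ ∃ z, IsLight i μ ν z ∧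
        ∀ t, (h t : ℤ) = (3 * (s : ℤ) - n) * omega i μ ν t - lam k n s * vegaInv i z t) := by
  let c : V → VegaVertex i := fun v => (e v).1
  have hc : ∀ v w, H.Adj v w ↔ (vega i).Adj (c v) (c w) := fun v w => e.map_rel_iff.symm
  have hkz : (k : ℤ) = 9 * i - 6 - (μ : ℕ) - (ν : ℕ) := by omega
  have hsum : ∑ z, classSize c z = (n : ℤ) := by rw [sum_classSize, hn]
  have hE : 2 * (#H.edgeFinset : ℤ) = (k : ℤ) * (k - 1) * n ^ 2 - 2 * k * (3 * k - 4) * n * s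
      + (3 * k - 4) * (3 * k - 1) * s ^ 2 := by
    have : 2 * (#H.edgeFinset : ℚ) = (k : ℚ) * (k - 1) * n ^ 2 - 2 * k * (3 * k - 4) * n * s
        + (3 * k - 4) * (3 * k - 1) * s ^ 2 := by
      rw [he, edgeBound]; ring
    exact_mod_cast this
  have key := weights_of_sum_mul_defect hi μ ν (classSize c) n s (lam k n s) hsum
    (by rw [lam, hkz]) (fun z => Int.natCast_nonneg _)
    (fun z => sub_nonneg.2 ((nbrSum_classSize_le hi H c hc z).trans (by exact_mod_cast hα)))
    (fun z hz => by
      rw [classSize, Nat.cast_eq_zero, card_eq_zero, filter_eq_empty_iff]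
      rintro v - rfl
      exact hz (e v).1.2)
    (by
      -- Here `h·d = ns - 2e(H)`, and `ns - 2g_k(n,s)` factors as `λ(3s - n - λ)`.
      simp only [defect, mul_sub, sum_sub_distrib, ← sum_mul, hsum,
        ← two_mul_card_edgeFinset H c hc, hE, lam]
      ring)
  have hcard : ∀ z : vegaVerts i μ ν, classSize c z = h z := card_fiber_blowUp e
  rcases key with ⟨hl, hh⟩ | ⟨hl, hle, z, hz, hh⟩
  · exact .inl ⟨hl, fun z => (hcard z).symm.trans (hh z)⟩
  · exact .inr ⟨hl, hle, z, hz, fun t => (hcard t).symm.trans (hh t)⟩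

end conclusion
end VegaExtremal

theorem lemma4p4 {V : Type*} [Fintype V] (i k n s : ℕ) (μ ν : Fin 2) (hi : 2 ≤ i)
    (hk : k = 9 * i - (6 + (μ : ℕ) + (ν : ℕ))) (hs : 1 ≤ s) (hsn : s ≤ n)
    (H : SimpleGraph V) [Fintype H.edgeSet]
    (hH : VegaExtremal.IsBlowUp H (VegaExtremal.vegaDel i μ ν))
    (hn : Fintype.card V = n) (hα : H.indepNum ≤ s)
    (he : (H.edgeFinset.card : ℚ) = VegaExtremal.edgeBound k n s) :
    (∃ (W : Type) (G : SimpleGraph W), VegaExtremal.ExtremalFamily n k s W G ∧ Nonempty (H ≃g G)) ∧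
    -- the class sizes, with the given `i`, `μ`, `ν`
    ∃ h : VegaExtremal.vegaVerts i μ ν → ℕ, Nonempty (H ≃g VegaExtremal.blowUp (VegaExtremal.vegaDel i μ ν) h) ∧
      (((s : ℚ) = k * n / (3 * k - 1) ∧
          ∀ z, (h z : ℤ) = (3 * (s : ℤ) - n) * VegaExtremal.omega i μ ν z) ∨
        ((k : ℚ) * n / (3 * k - 1) < s ∧ (s : ℚ) ≤ (k - 1) * n / (3 * k - 4) ∧
          ((μ = 0 ∧
              ∀ z, (h z : ℤ) = (3 * (s : ℤ) - n) * VegaExtremal.omega i μ ν z - VegaExtremal.lam k n s * VegaExtremal.f i z) ∨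
            (ν = 0 ∧
              ∀ z, (h z : ℤ) = (3 * (s : ℤ) - n) * VegaExtremal.omega i μ ν z - VegaExtremal.lam k n s * VegaExtremal.g i z)))) := by
  obtain ⟨h₀, ⟨e₀⟩⟩ := hH
  obtain ⟨h, ⟨e⟩, hw⟩ := VegaExtremal.exists_extremalWeights hi (by omega) e₀
    (VegaExtremal.exists_weights_of_card_edgeFinset hi hk H e₀ hn hα he)
  exact ⟨hw.exists_family hi hk e, h, ⟨e⟩, hw⟩
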